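/- Let $\varrho$ be the substitution $0\mapsto 02,\ 1\mapsto 32,\ 2\mapsto 01,\ 3\mapsto 31$ on $\{0,1,2,3\}$, and let $v\in\{0,1,2,3\}^{\mathbb Z}$ be any of the bi-infinite fixed points of $\varrho^2$ with seed $v_{-1}|v_0\in\{2|0,\,2|3,\,1|0,\,1|3\}$. The corresponding balanced binary Rudin–Shapiro sequence $w\in\{\pm1\}^{\mathbb Z}$ is given by $w_i=1$ if $v_i\in\{0,2\}$ and $w_i=-1$ if $v_i\in\{1,3\}$. For $n\ge 1$ and $m=(m_1,\dots,m_{n-1})\in\mathbb Z^{n-1}$, define the $n$-point and the signed $n$-point correlation functions (whenever the limits exist) by $$\eta^{(n)}(m)=\lim_{N\to\infty}\frac1{2N+1}\sum_{i=-N}^{N}w_i\,w_{i+m_1}\cdots w_{i+m_{n-1}},\qquad \theta^{(n)}(m)=\lim_{N\to\infty}\frac1{2N+1}\sum_{i=-N}^{N}(-1)^i\,w_i\,w_{i+m_1}\cdots w_{i+m_{n-1}} .$$ For $x\in\mathbb Z$ write $x=4q+\ell$ with $\ell\in\{0,1,2,3\}$, and set $q(x)=q$; $t(x)=0,\ \sigma(x)=1$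 if $\ell\in\{0,1\}$; and $t(x)=1,\ \sigma(x)=(-1)^{q+\ell}$ if $\ell\in\{2,3\}$. With $m_0:=0$, the $n$-point renormalisation equations for a pair of functions $F,G:\mathbb Z^{n-1}\to\mathbb R$ are $$F(m)=\frac14\sum_{k=0}^{3}T_k(m),\qquad G(m)=\frac14\sum_{k=0}^{3}(-1)^kT_k(m)\qquad(m\in\mathbb Z^{n-1}),$$ $$T_k(m)=\Bigl(\prod_{i=0}^{n-1}\sigma(m_i+k)\Bigr)\cdot H_k\bigl(q(m_1+k),\dots,q(m_{n-1}+k)\bigr),$$ where $H_k=F$ if $\sum_{i=0}^{n-1}t(m_i+k)$ is even and $H_k=G$ if it is odd. **Proposition.** Let $n\ge1$. 1. The limits $\eta^{(n)}(m)$ and $\theta^{(n)}(m)$ exist for all $m\in\mathbb Z^{n-1}$, and they are the same for each of the above Rudin–Shapiro sequences $w$. 2. All values of $\eta^{(n)}$ and $\theta^{(n)}$ are determined, through the renormalisation equations, by the single value $\eta^{(n)}(0,\dots,0)$: the pair $(\eta^{(n)},\theta^{(n)})$ satisfies the $n$-point renormalisation equations, and any two solutions $(F,G)$, $(F',G')$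 of these equations with $F(0,\dots,0)=F'(0,\dots,0)$ are equal. 3. If $n$ is odd, then $\eta^{(n)}$ and $\theta^{(n)}$ vanish identically. -/

import Mathlib

open Filter Topology

namespace RudinShapiro

/-- The quaternary substitution `0 ↦ 02`, `1 ↦ 32`, `2 ↦ 01`, `3 ↦ 31`. -/
def rho : Fin 4 → Fin 4 × Fin 4 :=
  ![(0, 2), (3, 2), (0, 1), (3, 1)]

/-- The substitution applied to a bi-infinite word: the image of the letter at position `i`
occupies the positions `2 * i` and `2 * i + 1`. -/
def applyRho (v : ℤ → Fin 4) (i : ℤ) : Fin 4 :=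
  if i % 2 = 0 then (rho (v (i / 2))).1 else (rho (v (i / 2))).2

/-- `v` is a bi-infinite quaternary Rudin--Shapiro sequence: a fixed point of the square of the
substitution with one of the legal seeds `2|0`, `2|3`, `1|0`, `1|3`
(the letters at the positions `-1` and `0`). -/
def IsQuaternary (v : ℤ → Fin 4) : Prop :=
  applyRho (applyRho v) = v ∧
    (v (-1), v 0) ∈ ({(2, 0), (2, 3), (1, 0), (1, 3)} : Set (Fin 4 × Fin 4))

/-- The coding `0, 2 ↦ a` and `1, 3 ↦ b` with the balanced weights `a = 1`, `b = -1`. -/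
def weight : Fin 4 → ℝ :=
  ![1, -1, 1, -1]

/-- `w` is one of the (four) bi-infinite balanced binary Rudin--Shapiro sequences. -/
def IsBinary (w : ℤ → ℝ) : Prop :=
  ∃ v : ℤ → Fin 4, IsQuaternary v ∧ w = fun i => weight (v i)

/-- The average over `-N ≤ i ≤ N` of `w i * w (i + m₁) * ⋯ * w (i + m_d)`. With `d = n - 1`, its
limit for `N → ∞` is the `n`-point correlation function at `(m₁, …, m_d)`. -/
noncomputable def etaAvg (w : ℤ → ℝ) {d : ℕ} (m : Fin d → ℤ) (N : ℕ) : ℝ :=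
  1 / (2 * (N : ℝ) + 1) * ∑ i ∈ Finset.Icc (-(N : ℤ)) N, w i * ∏ j, w (i + m j)

/-- The average over `-N ≤ i ≤ N` of `(-1) ^ i * w i * w (i + m₁) * ⋯ * w (i + m_d)`. With
`d = n - 1`, its limit for `N → ∞` is the signed `n`-point correlation function. -/
noncomputable def thetaAvg (w : ℤ → ℝ) {d : ℕ} (m : Fin d → ℤ) (N : ℕ) : ℝ :=
  1 / (2 * (N : ℝ) + 1) *
    ∑ i ∈ Finset.Icc (-(N : ℤ)) N, (-1 : ℝ) ^ i * (w i * ∏ j, w (i + m j))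

/-! The recursion `w (4 * q + l) = w q` for `l = 0, 1` and `w (4 * q + l) = (-1) ^ (q + l) * w q`
for `l = 2, 3` gives, for a summation index `4 * j + k` with `0 ≤ k ≤ 3` and for `x = 4 * q + l`
with `0 ≤ l ≤ 3`, that `w (4 * j + x) = (-1) ^ (twist x * j) * sgn x * w (j + q)`. Taking the
product over `x = k, m₁ + k, …, m_d + k` and averaging over `j` gives the renormalisation
equations below. -/

/-- `1` if the residue of `x` modulo `4` is `2` or `3`, and `0` otherwise. -/
def twist (x : ℤ) : ℕ :=
  if x % 4 = 2 ∨ x % 4 = 3 then 1 else 0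

/-- The sign `(-1) ^ (q + l)` if `x = 4 * q + l` with `l = 2, 3`, and `1` if `l = 0, 1`. -/
noncomputable def sgn (x : ℤ) : ℝ :=
  if x % 4 = 2 ∨ x % 4 = 3 then (-1 : ℝ) ^ (x / 4 + x % 4) else 1

/-- The contribution of the summation indices congruent to `k` modulo `4` (`0 ≤ k ≤ 3`) to the
right-hand side of the renormalisation equation for the correlations at `m`. The factor
`(-1) ^ j` survives exactly if the total number of twists is odd, and then the signed function
`G` occurs instead of `F`. -/
noncomputable def renormTerm {d : ℕ} (F G : (Fin d → ℤ) → ℝ) (m : Fin d → ℤ) (k : ℤ) : ℝ :=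
  (sgn k * ∏ j, sgn (m j + k)) *
    (if Even (twist k + ∑ j, twist (m j + k)) then F (fun j => (m j + k) / 4)
      else G (fun j => (m j + k) / 4))

/-- The renormalisation equations of the `(d + 1)`-point correlation functions, for a pair
`(F, G)` of unknown functions in place of the correlation function and the signed one. -/
def IsRenormSolution {d : ℕ} (F G : (Fin d → ℤ) → ℝ) : Prop :=
  ∀ m : Fin d → ℤ,
    F m = 1 / 4 * (renormTerm F G m 0 + renormTerm F G m 1
        + renormTerm F G m 2 + renormTerm F G m 3) ∧
    G m = 1 / 4 * (renormTerm F G m 0 - renormTerm F G m 1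
        + renormTerm F G m 2 - renormTerm F G m 3)

/-- The fixed point of the squared substitution with seed `x|y`, read off from base `4` digits. -/
def fixedPoint (x y : Fin 4) (i : ℤ) : Fin 4 :=
  if i = 0 then y else if i = -1 then x
  else
    let a := fixedPoint x y (i / 4)
    let b := if i / 2 % 2 = 0 then (rho a).1 else (rho a).2
    if i % 2 = 0 then (rho b).1 else (rho b).2
  termination_by i.natAbs
  decreasing_by omega

/-- Every legal seed gives a bi-infinite Rudin--Shapiro sequence. -/
theorem exists_isQuaternary (x y : Fin 4)
    (h : (x, y) ∈ ({(2, 0), (2, 3), (1, 0), (1, 3)} : Set (Fin 4 × Fin 4))) :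
    ∃ v : ℤ → Fin 4, IsQuaternary v ∧ v (-1) = x ∧ v 0 = y := by
  have h0 : fixedPoint x y 0 = y := by rw [fixedPoint]; simp
  have h1 : fixedPoint x y (-1) = x := by rw [fixedPoint]; simp
  refine ⟨fixedPoint x y, ⟨?_, by rw [h0, h1]; exact h⟩, h1, h0⟩
  funext i
  have e : i / 2 / 2 = i / 4 := by omega
  by_cases i0 : i = 0
  · subst i0
    simp only [applyRho]
    norm_num [h0]
    simp only [Set.mem_insert_iff, Set.mem_singleton_iff, Prod.mk.injEq] at h
    rcases h with ⟨rfl, rfl⟩ | ⟨rfl, rfl⟩ | ⟨rfl, rfl⟩ | ⟨rfl, rfl⟩ <;> rfl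
  by_cases i1 : i = -1
  · subst i1
    simp only [applyRho]
    norm_num [h1]
    simp only [Set.mem_insert_iff, Set.mem_singleton_iff, Prod.mk.injEq] at h
    rcases h with ⟨rfl, rfl⟩ | ⟨rfl, rfl⟩ | ⟨rfl, rfl⟩ | ⟨rfl, rfl⟩ <;> rfl
  · rw [fixedPoint.eq_def x y i]
    simp only [applyRho, e, i0, i1, if_false]

end RudinShapiro

/-!
The recursion `w (4 * q + l) = ± w q` makes the averages over `[-N, N]` satisfy the renormalisation
equations, with the averages over `[-N / 4, N / 4]` on the right-hand side, up to an error `O(1 / N)`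
(`correlations_asymptotic`). Call a family of pairs `(F p, G p)` that satisfies the equations in
this sense along a filter an asymptotic solution; the equations are linear, so that differences
of asymptotic solutions are again of this kind.

The heart of the proof is `IsAsymptoticSolution.tendsto_zero`: a pointwise bounded asymptotic
solution with `F p 0 → 0` tends to `0` everywhere. Indeed the maps `m ↦ (m + k) / 4` contract the
index set into `{-1, 0}^d ∪ {0, 1}^d`. On `{0, 1}^d` the first three of them lead to `0`, and the
fourth fixes `m`, with the weight `1 / 4`; similarly on `{-1, 0}^d`. At `0` itself, `G` reproduces
itself with weight at most `1 / 2`. A bounded quantity that is at most half of its value at a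
previous scale, up to `o(1)`, tends to `0`.

This lemma is used three times. For the difference of the averages of two sequences `w`, `w'` up to
`N` and `N'`, with `(N, N') → ∞`, it shows that the averages are Cauchy sequences with a limit
independent of `w`. For the difference of two solutions, viewed as a constant family, it is the
uniqueness statement. Finally, for an odd number of points the equations give `F 0 = F 0 / 2`, so
that the solution agrees at `0`, hence everywhere, with the zero solution.
-/

namespace RudinShapiro

/-! ### The recursion of the binary sequence -/

theorem applyRho_two_mul (v : ℤ → Fin 4) (i : ℤ) : applyRho v (2 * i) = (rho (v i)).1 := by
  have h1 : 2 * i % 2 = 0 := by omega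
  have h2 : 2 * i / 2 = i := by omega
  simp only [applyRho, h1, h2, if_true]

theorem applyRho_two_mul_add_one (v : ℤ → Fin 4) (i : ℤ) :
    applyRho v (2 * i + 1) = (rho (v i)).2 := by
  have h1 : ¬ (2 * i + 1) % 2 = 0 := by omega
  have h2 : (2 * i + 1) / 2 = i := by omega
  simp only [applyRho, h1, h2, if_false]

theorem rho_fst (a : Fin 4) : (rho a).1 = 0 ∨ (rho a).1 = 3 := by
  revert a; decide

theorem rho_snd (a : Fin 4) : (rho a).2 = 1 ∨ (rho a).2 = 2 := by
  revert a; decide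

/-- The letters `0, 3` occur exactly at the even positions. This is why the sign in the recursion of
`w`, which depends on the letter of `v`, can be expressed by the parity of its position. -/
theorem IsQuaternary.parity {v : ℤ → Fin 4} (hv : IsQuaternary v) (q : ℤ) :
    (Even q ∧ (v q = 0 ∨ v q = 3)) ∨ (Odd q ∧ (v q = 1 ∨ v q = 2)) := by
  rcases Int.even_or_odd' q with ⟨i, rfl | rfl⟩
  · left
    refine ⟨even_two_mul i, ?_⟩
    rw [← hv.1, applyRho_two_mul]
    exact rho_fst _
  · right
    refine ⟨odd_two_mul_add_one i, ?_⟩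
    rw [← hv.1, applyRho_two_mul_add_one]
    exact rho_snd _

theorem IsQuaternary.four_mul {v : ℤ → Fin 4} (hv : IsQuaternary v) (q : ℤ) :
    v (4 * q) = (rho (rho (v q)).1).1 ∧ v (4 * q + 1) = (rho (rho (v q)).1).2 ∧
      v (4 * q + 2) = (rho (rho (v q)).2).1 ∧ v (4 * q + 3) = (rho (rho (v q)).2).2 := by
  have e0 : 4 * q = 2 * (2 * q) := by ring
  have e1 : 4 * q + 1 = 2 * (2 * q) + 1 := by ring
  have e2 : 4 * q + 2 = 2 * (2 * q + 1) := by ring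
  have e3 : 4 * q + 3 = 2 * (2 * q + 1) + 1 := by ring
  refine ⟨?_, ?_, ?_, ?_⟩
  · conv_lhs => rw [← hv.1, e0, applyRho_two_mul, applyRho_two_mul]
  · conv_lhs => rw [← hv.1, e1, applyRho_two_mul_add_one, applyRho_two_mul]
  · conv_lhs => rw [← hv.1, e2, applyRho_two_mul, applyRho_two_mul_add_one]
  · conv_lhs => rw [← hv.1, e3, applyRho_two_mul_add_one, applyRho_two_mul_add_one]

theorem IsBinary.four_mul {w : ℤ → ℝ} (hw : IsBinary w) (q : ℤ) :
    w (4 * q) = w q ∧ w (4 * q + 1) = w q ∧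
      w (4 * q + 2) = (-1 : ℝ) ^ q * w q ∧ w (4 * q + 3) = -((-1 : ℝ) ^ q * w q) := by
  obtain ⟨v, hv, rfl⟩ := hw
  obtain ⟨h0, h1, h2, h3⟩ := hv.four_mul q
  simp only [h0, h1, h2, h3]
  rcases hv.parity q with ⟨hq, h | h⟩ | ⟨hq, h | h⟩ <;>
    simp [h, hq.neg_one_zpow, rho, weight]

theorem IsBinary.abs_eq_one {w : ℤ → ℝ} (hw : IsBinary w) (i : ℤ) : |w i| = 1 := by
  obtain ⟨v, -, rfl⟩ := hw
  have : ∀ a : Fin 4, |weight a| = 1 := by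
    intro a
    fin_cases a <;> simp [weight]
  exact this _

theorem IsBinary.four_mul_add {w : ℤ → ℝ} (hw : IsBinary w) (j x : ℤ) :
    w (4 * j + x) = ((-1 : ℝ) ^ j) ^ twist x * sgn x * w (j + x / 4) := by
  have h1 : (-1 : ℝ) ≠ 0 := by norm_num
  obtain ⟨a0, a1, a2, a3⟩ := hw.four_mul (j + x / 4)
  have hx : x % 4 = 0 ∨ x % 4 = 1 ∨ x % 4 = 2 ∨ x % 4 = 3 := by omega
  rcases hx with h | h | h | h
  · have e : 4 * j + x = 4 * (j + x / 4) := by omega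
    rw [e, a0]; simp [twist, sgn, h]
  · have e : 4 * j + x = 4 * (j + x / 4) + 1 := by omega
    rw [e, a1]; simp [twist, sgn, h]
  · have e : 4 * j + x = 4 * (j + x / 4) + 2 := by omega
    rw [e, a2]; simp [twist, sgn, h, zpow_add₀ h1]
  · have e : 4 * j + x = 4 * (j + x / 4) + 3 := by omega
    have e3 : (-1 : ℝ) ^ (3 : ℤ) = -1 := by norm_num
    rw [e, a3]; simp [twist, sgn, h, zpow_add₀ h1, e3]

theorem abs_sgn (x : ℤ) : |sgn x| = 1 := by
  unfold sgn
  split_ifs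
  · simp [abs_zpow]
  · simp

/-! ### Symmetric averages -/

/-- The average of `f` over `[-N, N]`. -/
noncomputable def avg (f : ℤ → ℝ) (N : ℕ) : ℝ :=
  1 / (2 * (N : ℝ) + 1) * ∑ i ∈ Finset.Icc (-(N : ℤ)) N, f i

theorem avg_add (f g : ℤ → ℝ) (N : ℕ) : avg (fun i => f i + g i) N = avg f N + avg g N := by
  simp only [avg, Finset.sum_add_distrib, mul_add]

theorem avg_mul_left (c : ℝ) (f : ℤ → ℝ) (N : ℕ) : avg (fun i => c * f i) N = c * avg f N := by
  simp only [avg, ← Finset.mul_sum]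
  ring

theorem card_Icc_neg (N : ℕ) : ((Finset.Icc (-(N : ℤ)) N).card : ℝ) = 2 * (N : ℝ) + 1 := by
  rw [Int.card_Icc]
  have : ((N : ℤ) + 1 - -(N : ℤ)).toNat = 2 * N + 1 := by omega
  rw [this]; push_cast; ring

theorem avg_const (c : ℝ) (N : ℕ) : avg (fun _ => c) N = c := by
  have : (2 * (N : ℝ) + 1) ≠ 0 := by positivity
  simp only [avg, Finset.sum_const, nsmul_eq_mul, card_Icc_neg]
  field_simp

theorem abs_sum_le_card {f : ℤ → ℝ} (hf : ∀ i, |f i| ≤ 1) (s : Finset ℤ) :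
    |∑ i ∈ s, f i| ≤ s.card := by
  refine (Finset.abs_sum_le_sum_abs _ _).trans ?_
  simpa using Finset.sum_le_card_nsmul s (fun i => |f i|) 1 fun i _ => hf i

theorem abs_avg_le {f : ℤ → ℝ} (hf : ∀ i, |f i| ≤ 1) (N : ℕ) : |avg f N| ≤ 1 := by
  have h0 : 0 < 2 * (N : ℝ) + 1 := by positivity
  have h := abs_sum_le_card hf (Finset.Icc (-(N : ℤ)) N)
  rw [card_Icc_neg] at h
  rw [avg, abs_mul, abs_of_pos (by positivity), one_div, inv_mul_le_iff₀ h0]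
  simpa using h

theorem sum_blocks (f : ℤ → ℝ) (M : ℕ) :
    ∑ j ∈ Finset.Icc (-(M : ℤ)) M, (f (4 * j) + f (4 * j + 1) + f (4 * j + 2) + f (4 * j + 3)) =
      ∑ i ∈ Finset.Icc (-(4 * M : ℤ)) (4 * M + 3), f i := by
  have hmaps : ∀ i ∈ Finset.Icc (-(4 * M : ℤ)) (4 * M + 3), i / 4 ∈ Finset.Icc (-(M : ℤ)) M := by
    intro i hi
    simp only [Finset.mem_Icc] at hi ⊢
    omega
  rw [← Finset.sum_fiberwise_of_maps_to hmaps]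
  refine Finset.sum_congr rfl fun j hj => ?_
  have : (Finset.Icc (-(4 * M : ℤ)) (4 * M + 3)).filter (fun i => i / 4 = j) =
      {4 * j, 4 * j + 1, 4 * j + 2, 4 * j + 3} := by
    ext i
    simp only [Finset.mem_Icc, Finset.mem_filter, Finset.mem_insert, Finset.mem_singleton] at hj ⊢
    omega
  rw [this, Finset.sum_insert (by simp), Finset.sum_insert (by simp),
    Finset.sum_insert (by simp), Finset.sum_singleton]
  ring

/-- The interval `[-N, N]` and the union of the blocks `[4 * j, 4 * j + 3]` with `|j| ≤ N / 4` differ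
by at most three points on each side. -/
theorem abs_sum_sub_sum_blocks_le {f : ℤ → ℝ} (hf : ∀ i, |f i| ≤ 1) (N : ℕ) :
    |∑ i ∈ Finset.Icc (-(N : ℤ)) N, f i -
      ∑ i ∈ Finset.Icc (-(4 * (N / 4 : ℕ) : ℤ)) (4 * (N / 4 : ℕ) + 3), f i| ≤ 6 := by
  set M := N / 4 with hM
  have hMN : 4 * M ≤ N ∧ N ≤ 4 * M + 3 := by omega
  have h1 : Finset.Icc (-(4 * M : ℤ)) (N : ℤ) ⊆ Finset.Icc (-(N : ℤ)) N :=
    Finset.Icc_subset_Icc (by omega) le_rfl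
  have h2 : Finset.Icc (-(4 * M : ℤ)) (N : ℤ) ⊆ Finset.Icc (-(4 * M : ℤ)) (4 * M + 3) :=
    Finset.Icc_subset_Icc le_rfl (by omega)
  have c1 := abs_sum_le_card hf (Finset.Icc (-(N : ℤ)) N \ Finset.Icc (-(4 * M : ℤ)) (N : ℤ))
  have c2 := abs_sum_le_card hf
    (Finset.Icc (-(4 * M : ℤ)) (4 * M + 3) \ Finset.Icc (-(4 * M : ℤ)) (N : ℤ))
  rw [← Finset.sum_sdiff h1, ← Finset.sum_sdiff h2]
  have d1 : ((Finset.Icc (-(N : ℤ)) N \ Finset.Icc (-(4 * M : ℤ)) (N : ℤ)).card : ℝ) ≤ 3 := by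
    rw [Finset.card_sdiff_of_subset h1, Int.card_Icc, Int.card_Icc]
    exact_mod_cast (by omega)
  have d2 : ((Finset.Icc (-(4 * M : ℤ)) (4 * M + 3) \
      Finset.Icc (-(4 * M : ℤ)) (N : ℤ)).card : ℝ) ≤ 3 := by
    rw [Finset.card_sdiff_of_subset h2, Int.card_Icc, Int.card_Icc]
    exact_mod_cast (by omega)
  rw [abs_le] at c1 c2 ⊢
  constructor <;> linarith [c1.1, c1.2, c2.1, c2.2]

theorem abs_avg_sub_avg_blocks_le {f : ℤ → ℝ} (hf : ∀ i, |f i| ≤ 1) (N : ℕ) :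
    |avg f N - avg (fun j => 1 / 4 * (f (4 * j) + f (4 * j + 1) + f (4 * j + 2) + f (4 * j + 3)))
      (N / 4)| ≤ 9 / (2 * (N : ℝ) + 1) := by
  have hS := abs_sum_sub_sum_blocks_le hf N
  have hT := abs_sum_le_card hf (Finset.Icc (-(4 * (N / 4 : ℕ) : ℤ)) (4 * (N / 4 : ℕ) + 3))
  rw [avg_mul_left]
  simp only [avg]
  rw [sum_blocks]
  set M := N / 4 with hM
  set S := ∑ i ∈ Finset.Icc (-(N : ℤ)) N, f i
  set T := ∑ i ∈ Finset.Icc (-(4 * M : ℤ)) (4 * M + 3), f i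
  have hc : ((Finset.Icc (-(4 * M : ℤ)) (4 * M + 3)).card : ℝ) = 8 * M + 4 := by
    rw [Int.card_Icc]
    have : ((4 * M : ℤ) + 3 + 1 - -(4 * M : ℤ)).toNat = 8 * M + 4 := by omega
    rw [this]; push_cast; ring
  rw [hc] at hT
  have hMN : 4 * (M : ℝ) ≤ N ∧ (N : ℝ) ≤ 4 * M + 3 := by
    constructor <;> exact_mod_cast (by omega)
  have p1 : 0 < 2 * (N : ℝ) + 1 := by positivity
  have p2 : 0 < 8 * (M : ℝ) + 4 := by positivity
  -- Normalise both sums by `2 * N + 1`; the second one changes by a factor `1 + O(1 / N)`.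
  have e : 1 / (2 * (N : ℝ) + 1) * S - 1 / 4 * (1 / (2 * (M : ℝ) + 1) * T) =
      ((S - T) + T / (8 * (M : ℝ) + 4) * (8 * M + 4 - (2 * N + 1))) / (2 * (N : ℝ) + 1) := by
    field_simp
    ring
  rw [e, abs_div, abs_of_pos p1]
  gcongr
  have hq : |T / (8 * (M : ℝ) + 4)| ≤ 1 := by
    rw [abs_div, abs_of_pos p2, div_le_one p2]; exact hT
  have hr : |8 * (M : ℝ) + 4 - (2 * N + 1)| ≤ 3 := by
    rw [abs_le]; constructor <;> linarith
  calc _ ≤ |S - T| + |T / (8 * (M : ℝ) + 4) * (8 * M + 4 - (2 * N + 1))| := abs_add_le _ _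
    _ ≤ 6 + 1 * 3 := by
      rw [abs_mul]
      gcongr
    _ = 9 := by norm_num

theorem tendsto_avg_sub_avg_blocks {f : ℤ → ℝ} (hf : ∀ i, |f i| ≤ 1) :
    Tendsto (fun N => avg f N - avg (fun j => 1 / 4 * (f (4 * j) + f (4 * j + 1) +
      f (4 * j + 2) + f (4 * j + 3))) (N / 4)) atTop (𝓝 0) := by
  refine squeeze_zero_norm (fun N => abs_avg_sub_avg_blocks_le hf N) ?_
  refine Tendsto.const_div_atTop ?_ _
  exact tendsto_atTop_add_const_right _ _
    (tendsto_natCast_atTop_atTop.const_mul_atTop (by norm_num))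

/-! ### Contraction of asymptotic solutions -/

section Asymptotic

variable {ι : Type*} {d : ℕ}

/-- A family of pairs `(F p, G p)` that satisfies the renormalisation equations asymptotically along
the filter `l`, where the right-hand side is taken at the preceding scale `s p`. -/
def IsAsymptoticSolution (l : Filter ι) (s : ι → ι) (F G : ι → (Fin d → ℤ) → ℝ) : Prop :=
  ∀ m : Fin d → ℤ,
    Tendsto (fun p => F p m - 1 / 4 * (renormTerm (F (s p)) (G (s p)) m 0 +
      renormTerm (F (s p)) (G (s p)) m 1 + renormTerm (F (s p)) (G (s p)) m 2 +
      renormTerm (F (s p)) (G (s p)) m 3)) l (𝓝 0) ∧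
    Tendsto (fun p => G p m - 1 / 4 * (renormTerm (F (s p)) (G (s p)) m 0 -
      renormTerm (F (s p)) (G (s p)) m 1 + renormTerm (F (s p)) (G (s p)) m 2 -
      renormTerm (F (s p)) (G (s p)) m 3)) l (𝓝 0)

theorem renormTerm_sub (F G F' G' : (Fin d → ℤ) → ℝ) (m : Fin d → ℤ) (k : ℤ) :
    renormTerm (F - F') (G - G') m k = renormTerm F G m k - renormTerm F' G' m k := by
  unfold renormTerm
  split_ifs <;> simp [mul_sub]

theorem abs_renormTerm_le (F G : (Fin d → ℤ) → ℝ) (m : Fin d → ℤ) (k : ℤ) :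
    |renormTerm F G m k| ≤
      max |F (fun j => (m j + k) / 4)| |G (fun j => (m j + k) / 4)| := by
  unfold renormTerm
  rw [abs_mul, abs_mul, Finset.abs_prod]
  simp only [abs_sgn, Finset.prod_const_one, one_mul]
  split_ifs
  · exact le_max_left _ _
  · exact le_max_right _ _

theorem renormTerm_zero_of_lt_two (F G : (Fin d → ℤ) → ℝ) {k : ℤ} (hk : k = 0 ∨ k = 1) :
    renormTerm F G (fun _ => 0) k = F (fun _ => 0) := by
  rcases hk with rfl | rfl <;> simp [renormTerm, sgn, twist]

/-- A bounded nonnegative quantity that is at most half of its value at the preceding scale, up to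
`o(1)`, tends to `0`. -/
theorem tendsto_zero_of_le_half {l : Filter ι} {s : ι → ι} (hs : Tendsto s l l)
    {a e : ι → ℝ} (ha0 : ∀ p, 0 ≤ a p) {C : ℝ} (haC : ∀ p, a p ≤ C)
    (he : Tendsto e l (𝓝 0)) (h : ∀ p, a p ≤ 1 / 2 * a (s p) + e p) :
    Tendsto a l (𝓝 0) := by
  have key : ∀ δ > 0, ∀ k : ℕ, ∀ᶠ p in l, a p ≤ C * (1 / 2) ^ k + δ := by
    intro δ hδ k
    induction k with
    | zero =>
      refine Eventually.of_forall fun p => ?_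
      have := haC p
      simp only [pow_zero, mul_one]
      linarith
    | succ k ih =>
      filter_upwards [hs.eventually ih, he.eventually (ge_mem_nhds (half_pos hδ))] with p h1 h2
      have h3 := h p
      rw [pow_succ]
      linarith
  rw [Metric.tendsto_nhds]
  intro ε hε
  have hlim : Tendsto (fun k : ℕ => C * (1 / 2 : ℝ) ^ k) atTop (𝓝 0) := by
    simpa using (tendsto_pow_atTop_nhds_zero_of_lt_one (r := (1 / 2 : ℝ)) (by norm_num)
      (by norm_num)).const_mul C
  obtain ⟨k, hk⟩ := (hlim.eventually (gt_mem_nhds (half_pos hε))).exists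
  filter_upwards [key (ε / 2) (half_pos hε) k] with p hp
  rw [Real.dist_eq, sub_zero, abs_of_nonneg (ha0 p)]
  linarith

variable {l : Filter ι} {s : ι → ι} {F G : ι → (Fin d → ℤ) → ℝ}

theorem IsAsymptoticSolution.sub {F' G' : ι → (Fin d → ℤ) → ℝ}
    (h : IsAsymptoticSolution l s F G) (h' : IsAsymptoticSolution l s F' G') :
    IsAsymptoticSolution l s (fun p => F p - F' p) (fun p => G p - G' p) := by
  intro m
  constructor
  · have := (h m).1.sub (h' m).1
    rw [sub_zero] at this
    refine this.congr fun p => ?_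
    simp only [renormTerm_sub, Pi.sub_apply]
    ring
  · have := (h m).2.sub (h' m).2
    rw [sub_zero] at this
    refine this.congr fun p => ?_
    simp only [renormTerm_sub, Pi.sub_apply]
    ring

theorem IsAsymptoticSolution.comp {κ : Type*} {l' : Filter κ} {s' : κ → κ} {φ : κ → ι}
    (h : IsAsymptoticSolution l s F G) (hφ : Tendsto φ l' l) (hc : ∀ p, φ (s' p) = s (φ p)) :
    IsAsymptoticSolution l' s' (fun p => F (φ p)) (fun p => G (φ p)) := by
  intro m
  simp only [hc]
  exact ⟨(h m).1.comp hφ, (h m).2.comp hφ⟩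

/-- The larger of the absolute values of the two components is, up to `o(1)`, at most its mean over
the four successors `(m + k) / 4` of `m`. -/
theorem IsAsymptoticSolution.exists_max_le (h : IsAsymptoticSolution l s F G) (m : Fin d → ℤ) :
    ∃ e : ι → ℝ, Tendsto e l (𝓝 0) ∧ ∀ p, max |F p m| |G p m| ≤
      1 / 4 * ∑ k : Fin 4, max |F (s p) (fun j => (m j + (k : ℕ)) / 4)|
        |G (s p) (fun j => (m j + (k : ℕ)) / 4)| + e p := by
  obtain ⟨h1, h2⟩ := h m
  refine ⟨_, by simpa using h1.abs.add h2.abs, fun p => ?_⟩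
  have t0 := abs_renormTerm_le (F (s p)) (G (s p)) m 0
  have t1 := abs_renormTerm_le (F (s p)) (G (s p)) m 1
  have t2 := abs_renormTerm_le (F (s p)) (G (s p)) m 2
  have t3 := abs_renormTerm_le (F (s p)) (G (s p)) m 3
  have hsum : ∑ k : Fin 4, max |F (s p) (fun j => (m j + (k : ℕ)) / 4)|
        |G (s p) (fun j => (m j + (k : ℕ)) / 4)| =
      max |F (s p) (fun j => (m j + 0) / 4)| |G (s p) (fun j => (m j + 0) / 4)| +
      max |F (s p) (fun j => (m j + 1) / 4)| |G (s p) (fun j => (m j + 1) / 4)| +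
      max |F (s p) (fun j => (m j + 2) / 4)| |G (s p) (fun j => (m j + 2) / 4)| +
      max |F (s p) (fun j => (m j + 3) / 4)| |G (s p) (fun j => (m j + 3) / 4)| := by
    rw [Fin.sum_univ_four]; rfl
  rw [hsum]
  set T := renormTerm (F (s p)) (G (s p)) m
  rw [abs_le] at t0 t1 t2 t3
  have a1 := abs_le.mp (le_refl |F p m - 1 / 4 * (T 0 + T 1 + T 2 + T 3)|)
  have a2 := abs_le.mp (le_refl |G p m - 1 / 4 * (T 0 - T 1 + T 2 - T 3)|)
  have b1 := abs_nonneg (F p m - 1 / 4 * (T 0 + T 1 + T 2 + T 3))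
  have b2 := abs_nonneg (G p m - 1 / 4 * (T 0 - T 1 + T 2 - T 3))
  refine max_le (abs_le.mpr ⟨?_, ?_⟩) (abs_le.mpr ⟨?_, ?_⟩) <;>
    linarith [a1.1, a1.2, a2.1, a2.2, t0.1, t0.2, t1.1, t1.2, t2.1, t2.2, t3.1, t3.2]

theorem IsAsymptoticSolution.tendsto_max_at_zero (hs : Tendsto s l l)
    (h : IsAsymptoticSolution l s F G)
    (hG : ∀ m, ∃ C, ∀ p, |G p m| ≤ C)
    (h0 : Tendsto (fun p => F p (fun _ => 0)) l (𝓝 0)) :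
    Tendsto (fun p => max |F p (fun _ => 0)| |G p (fun _ => 0)|) l (𝓝 0) := by
  obtain ⟨C, hC⟩ := hG fun _ => 0
  have hF0 : Tendsto (fun p => |F p (fun _ => 0)|) l (𝓝 0) := by simpa using h0.abs
  have hG0 : Tendsto (fun p => |G p (fun _ => 0)|) l (𝓝 0) := by
    have he := (h fun _ => 0).2.abs.add (hF0.comp hs)
    rw [abs_zero, add_zero] at he
    refine tendsto_zero_of_le_half hs (fun p => abs_nonneg _) hC he fun p => ?_
    -- The terms with `k = 0, 1` cancel in the equation for `G`.
    have t0 := renormTerm_zero_of_lt_two (F (s p)) (G (s p)) (Or.inl rfl : (0 : ℤ) = 0 ∨ _)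
    have t1 := renormTerm_zero_of_lt_two (F (s p)) (G (s p)) (Or.inr rfl : (1 : ℤ) = 0 ∨ _)
    have t2 := abs_renormTerm_le (F (s p)) (G (s p)) (fun _ => 0) 2
    have t3 := abs_renormTerm_le (F (s p)) (G (s p)) (fun _ => 0) 3
    norm_num at t2 t3
    have t2' : |renormTerm (F (s p)) (G (s p)) (fun _ => 0) 2| ≤
        |F (s p) fun _ => 0| + |G (s p) fun _ => 0| := by
      rcases t2 with t | t <;>
        linarith [abs_nonneg (F (s p) fun _ => 0), abs_nonneg (G (s p) fun _ => 0)]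
    have t3' : |renormTerm (F (s p)) (G (s p)) (fun _ => 0) 3| ≤
        |F (s p) fun _ => 0| + |G (s p) fun _ => 0| := by
      rcases t3 with t | t <;>
        linarith [abs_nonneg (F (s p) fun _ => 0), abs_nonneg (G (s p) fun _ => 0)]
    simp only [Function.comp_apply, t0, t1]
    set T := renormTerm (F (s p)) (G (s p)) (fun _ => 0)
    set f := |F (s p) fun _ => 0|
    rw [abs_le] at t2' t3'
    have a := abs_le.mp (le_refl |G p (fun _ => 0) -
      1 / 4 * (F (s p) (fun _ => 0) - F (s p) (fun _ => 0) + T 2 - T 3)|)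
    have f0 : 0 ≤ f := abs_nonneg _
    refine abs_le.mpr ⟨?_, ?_⟩ <;>
      linarith [a.1, a.2, t2'.1, t2'.2, t3'.1, t3'.2]
  simpa using hF0.max hG0

/-- If one successor of `m` is `m` itself and all others are already known to tend to `0`, then so
does the value at `m`. -/
theorem IsAsymptoticSolution.tendsto_max_of_fixed (hs : Tendsto s l l)
    (h : IsAsymptoticSolution l s F G)
    (hF : ∀ m, ∃ C, ∀ p, |F p m| ≤ C) (hG : ∀ m, ∃ C, ∀ p, |G p m| ≤ C)
    (m : Fin d → ℤ) (k₀ : Fin 4)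
    (hm : ∀ k : Fin 4, k ≠ k₀ →
      Tendsto (fun p => max |F p (fun j => (m j + (k : ℕ)) / 4)|
        |G p (fun j => (m j + (k : ℕ)) / 4)|) l (𝓝 0))
    (hfix : (fun j => (m j + (k₀ : ℕ)) / 4) = m) :
    Tendsto (fun p => max |F p m| |G p m|) l (𝓝 0) := by
  obtain ⟨C, hC⟩ := hF m
  obtain ⟨C', hC'⟩ := hG m
  obtain ⟨e, he, hle⟩ := h.exists_max_le m
  have hsum := (tendsto_finsetSum (Finset.univ.erase k₀) fun k hk =>
    (hm k (Finset.ne_of_mem_erase hk)).comp hs)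
  have htot := hsum.add he
  simp only [Finset.sum_const_zero, add_zero] at htot
  refine tendsto_zero_of_le_half hs (fun p => le_max_of_le_left (abs_nonneg _))
    (fun p => max_le_max (hC p) (hC' p)) htot fun p => ?_
  have h1 := hle p
  rw [← Finset.add_sum_erase _ _ (Finset.mem_univ k₀), hfix] at h1
  have h2 : 0 ≤ ∑ k ∈ Finset.univ.erase k₀, max |F (s p) (fun j => (m j + ((k : ℕ) : ℤ)) / 4)|
      |G (s p) (fun j => (m j + ((k : ℕ) : ℤ)) / 4)| :=
    Finset.sum_nonneg fun k _ => le_max_of_le_left (abs_nonneg _)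
  have h3 : 0 ≤ max |F (s p) m| |G (s p) m| := le_max_of_le_left (abs_nonneg _)
  simp only [Function.comp_apply]
  linarith

/-- If all successors of `m` are known to tend to `0`, then so does the value at `m`. -/
theorem IsAsymptoticSolution.tendsto_max_of_successors (hs : Tendsto s l l)
    (h : IsAsymptoticSolution l s F G) (m : Fin d → ℤ)
    (hm : ∀ k : Fin 4, Tendsto (fun p => max |F p (fun j => (m j + (k : ℕ)) / 4)|
        |G p (fun j => (m j + (k : ℕ)) / 4)|) l (𝓝 0)) :
    Tendsto (fun p => max |F p m| |G p m|) l (𝓝 0) := by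
  obtain ⟨e, he, hle⟩ := h.exists_max_le m
  have hsum := ((tendsto_finsetSum Finset.univ fun k _ => (hm k).comp hs).const_mul (1 / 4)).add he
  simp only [Finset.sum_const_zero, mul_zero, add_zero] at hsum
  exact squeeze_zero (fun p => le_max_of_le_left (abs_nonneg _)) hle hsum

theorem IsAsymptoticSolution.tendsto_max (hs : Tendsto s l l)
    (h : IsAsymptoticSolution l s F G)
    (hF : ∀ m, ∃ C, ∀ p, |F p m| ≤ C) (hG : ∀ m, ∃ C, ∀ p, |G p m| ≤ C)
    (h0 : Tendsto (fun p => F p (fun _ => 0)) l (𝓝 0)) (m : Fin d → ℤ) :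
    Tendsto (fun p => max |F p m| |G p m|) l (𝓝 0) := by
  have hzero := h.tendsto_max_at_zero hs hG h0
  have hpos : ∀ m : Fin d → ℤ, (∀ j, 0 ≤ m j ∧ m j ≤ 1) →
      Tendsto (fun p => max |F p m| |G p m|) l (𝓝 0) := by
    intro m hm
    refine h.tendsto_max_of_fixed hs hF hG m 3 (fun k hk => ?_) ?_
    · have hk3 : (k : ℕ) < 3 := by
        have : (k : ℕ) ≠ 3 := fun hh => hk (Fin.ext hh)
        omega
      have : (fun j => (m j + (k : ℕ)) / 4) = fun _ => (0 : ℤ) := by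
        funext j
        have := hm j
        omega
      rw [this]
      exact hzero
    · funext j
      have := hm j
      change (m j + 3) / 4 = m j
      omega
  have hneg : ∀ m : Fin d → ℤ, (∀ j, -1 ≤ m j ∧ m j ≤ 0) →
      Tendsto (fun p => max |F p m| |G p m|) l (𝓝 0) := by
    intro m hm
    refine h.tendsto_max_of_fixed hs hF hG m 0 (fun k hk => ?_) ?_
    · have hk0 : 0 < (k : ℕ) := by
        have : (k : ℕ) ≠ 0 := fun hh => hk (Fin.ext hh)
        omega
      have : (fun j => (m j + (k : ℕ)) / 4) = fun _ => (0 : ℤ) := by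
        funext j
        have := hm j
        omega
      rw [this]
      exact hzero
    · funext j
      have := hm j
      change (m j + 0) / 4 = m j
      omega
  have hbox : ∀ (B : ℕ) (m : Fin d → ℤ), (∀ j, |m j| ≤ B + 1) →
      Tendsto (fun p => max |F p m| |G p m|) l (𝓝 0) := by
    intro B
    induction B with
    | zero =>
      -- On `{-1, 0, 1}^d`, the successors for `k ≤ 2` have no entry `1`, and the one for `k = 3`
      -- has no entry `-1`.
      intro m hm
      refine h.tendsto_max_of_successors hs m fun k => ?_
      by_cases hk : (k : ℕ) = 3
      · refine hpos _ fun j => ?_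
        have := abs_le.mp (hm j)
        omega
      · refine hneg _ fun j => ?_
        have := abs_le.mp (hm j)
        omega
    | succ B ih =>
      intro m hm
      refine h.tendsto_max_of_successors hs m fun k => ih _ fun j => ?_
      have := abs_le.mp (hm j)
      push_cast at this
      rw [abs_le]
      omega
  refine hbox (∑ j, (m j).natAbs) m fun j => ?_
  have := Finset.single_le_sum (f := fun j => (m j).natAbs) (fun _ _ => Nat.zero_le _)
    (Finset.mem_univ j)
  rw [Int.abs_eq_natAbs]
  exact_mod_cast this.trans (Nat.le_succ _)

theorem IsAsymptoticSolution.tendsto_zero (hs : Tendsto s l l)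
    (h : IsAsymptoticSolution l s F G)
    (hF : ∀ m, ∃ C, ∀ p, |F p m| ≤ C) (hG : ∀ m, ∃ C, ∀ p, |G p m| ≤ C)
    (h0 : Tendsto (fun p => F p (fun _ => 0)) l (𝓝 0)) (m : Fin d → ℤ) :
    Tendsto (fun p => F p m) l (𝓝 0) ∧ Tendsto (fun p => G p m) l (𝓝 0) :=
  ⟨squeeze_zero_norm (fun _ => le_max_left _ _) (h.tendsto_max hs hF hG h0 m),
    squeeze_zero_norm (fun _ => le_max_right _ _) (h.tendsto_max hs hF hG h0 m)⟩

/-- For an odd number `d + 1` of points, the twisted terms at `0` cancel in the equation for `F`. -/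
theorem renormTerm_sum_zero_of_even (hd : Even d) (F G : (Fin d → ℤ) → ℝ) :
    1 / 4 * (renormTerm F G (fun _ => 0) 0 + renormTerm F G (fun _ => 0) 1 +
      renormTerm F G (fun _ => 0) 2 + renormTerm F G (fun _ => 0) 3) =
      1 / 2 * F (fun _ => 0) := by
  rw [renormTerm_zero_of_lt_two F G (Or.inl rfl), renormTerm_zero_of_lt_two F G (Or.inr rfl)]
  have e3 : (-1 : ℝ) ^ (3 : ℤ) = -1 := by norm_num
  have hpar : ¬ Even (1 + d) := by
    rw [Nat.not_even_iff_odd]; exact odd_one.add_even hd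
  have h2 : renormTerm F G (fun _ => 0) 2 = G (fun _ => 0) := by
    simp [renormTerm, sgn, twist, hpar]
  have h3 : renormTerm F G (fun _ => 0) 3 = -G (fun _ => 0) := by
    simp [renormTerm, sgn, twist, hpar, e3, hd.neg_one_pow]
  rw [h2, h3]
  ring

/-! ### Solutions of the renormalisation equations -/

/-- A limit of asymptotic solutions is a solution. -/
theorem IsAsymptoticSolution.isRenormSolution [l.NeBot] (hs : Tendsto s l l)
    (h : IsAsymptoticSolution l s F G) {η θ : (Fin d → ℤ) → ℝ}
    (hη : ∀ m, Tendsto (fun p => F p m) l (𝓝 (η m)))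
    (hθ : ∀ m, Tendsto (fun p => G p m) l (𝓝 (θ m))) : IsRenormSolution η θ := by
  have ht : ∀ m k, Tendsto (fun p => renormTerm (F (s p)) (G (s p)) m k) l
      (𝓝 (renormTerm η θ m k)) := by
    intro m k
    unfold renormTerm
    split_ifs
    · exact ((hη _).comp hs).const_mul _
    · exact ((hθ _).comp hs).const_mul _
  intro m
  constructor
  · refine sub_eq_zero.mp (tendsto_nhds_unique ((hη m).sub ?_) (h m).1)
    exact ((((ht m 0).add (ht m 1)).add (ht m 2)).add (ht m 3)).const_mul _
  · refine sub_eq_zero.mp (tendsto_nhds_unique ((hθ m).sub ?_) (h m).2)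
    exact ((((ht m 0).sub (ht m 1)).add (ht m 2)).sub (ht m 3)).const_mul _

theorem IsRenormSolution.isAsymptoticSolution {F G : (Fin d → ℤ) → ℝ}
    (h : IsRenormSolution F G) (l : Filter ι) (s : ι → ι) :
    IsAsymptoticSolution l s (fun _ => F) (fun _ => G) := by
  intro m
  simp only [← (h m).1, ← (h m).2, sub_self]
  exact ⟨tendsto_const_nhds, tendsto_const_nhds⟩

theorem IsRenormSolution.eq_of_eq_at_zero {F G F' G' : (Fin d → ℤ) → ℝ}
    (h : IsRenormSolution F G) (h' : IsRenormSolution F' G')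
    (h0 : F (fun _ => 0) = F' (fun _ => 0)) : F = F' ∧ G = G' := by
  have key := ((h.isAsymptoticSolution (⊤ : Filter Unit) id).sub
    (h'.isAsymptoticSolution ⊤ id)).tendsto_zero tendsto_id (fun m => ⟨_, fun _ => le_rfl⟩)
    (fun m => ⟨_, fun _ => le_rfl⟩) (by simp [h0])
  constructor
  · funext m
    exact sub_eq_zero.mp (tendsto_nhds_unique tendsto_const_nhds (key m).1)
  · funext m
    exact sub_eq_zero.mp (tendsto_nhds_unique tendsto_const_nhds (key m).2)

theorem isRenormSolution_zero : IsRenormSolution (0 : (Fin d → ℤ) → ℝ) 0 := by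
  intro m
  simp [renormTerm]

theorem IsRenormSolution.eq_zero_of_even (hd : Even d) {F G : (Fin d → ℤ) → ℝ}
    (h : IsRenormSolution F G) : F = 0 ∧ G = 0 := by
  refine h.eq_of_eq_at_zero isRenormSolution_zero ?_
  have h0 := (h fun _ => 0).1
  rw [renormTerm_sum_zero_of_even hd] at h0
  change F (fun _ => 0) = 0
  linarith

end Asymptotic

/-! ### Correlations -/

section Correlation

variable {d : ℕ} {w : ℤ → ℝ}

/-- The summand `w i * w (i + m₁) * ⋯ * w (i + m_d)` of the correlation at `m`. -/
def corr (w : ℤ → ℝ) (m : Fin d → ℤ) (i : ℤ) : ℝ :=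
  w i * ∏ j, w (i + m j)

theorem etaAvg_eq (w : ℤ → ℝ) (m : Fin d → ℤ) (N : ℕ) : etaAvg w m N = avg (corr w m) N := rfl

theorem thetaAvg_eq (w : ℤ → ℝ) (m : Fin d → ℤ) (N : ℕ) :
    thetaAvg w m N = avg (fun i => (-1 : ℝ) ^ i * corr w m i) N := rfl

theorem IsBinary.abs_corr (hw : IsBinary w) (m : Fin d → ℤ) (i : ℤ) : |corr w m i| = 1 := by
  simp [corr, abs_mul, Finset.abs_prod, hw.abs_eq_one]

theorem IsBinary.abs_neg_one_zpow_mul_corr (hw : IsBinary w) (m : Fin d → ℤ) (i : ℤ) :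
    |(-1 : ℝ) ^ i * corr w m i| = 1 := by
  simp [abs_mul, abs_zpow, hw.abs_corr]

theorem IsBinary.corr_four_mul_add (hw : IsBinary w) (m : Fin d → ℤ) (k : ℤ)
    (hk : 0 ≤ k ∧ k < 4) (i : ℤ) :
    corr w m (4 * i + k) = (sgn k * ∏ j, sgn (m j + k)) *
      (((-1 : ℝ) ^ i) ^ (twist k + ∑ j, twist (m j + k)) *
        corr w (fun j => (m j + k) / 4) i) := by
  have hk4 : k / 4 = 0 := by omega
  have e : ∀ j, 4 * i + k + m j = 4 * i + (m j + k) := fun j => by ring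
  simp only [corr, e, hw.four_mul_add, hk4, add_zero, Finset.prod_mul_distrib,
    Finset.prod_pow_eq_pow_sum, pow_add]
  ring

theorem IsBinary.avg_corr_four_mul_add (hw : IsBinary w) (m : Fin d → ℤ) (k : ℤ)
    (hk : 0 ≤ k ∧ k < 4) (N : ℕ) :
    avg (fun i => corr w m (4 * i + k)) N =
      renormTerm (fun m => etaAvg w m N) (fun m => thetaAvg w m N) m k := by
  simp only [hw.corr_four_mul_add m k hk, avg_mul_left, renormTerm, etaAvg_eq, thetaAvg_eq]
  have hsq : ∀ i : ℤ, ((-1 : ℝ) ^ i) ^ 2 = 1 := by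
    intro i
    rcases Int.even_or_odd i with h | h <;> simp [h.neg_one_zpow]
  split_ifs with hE
  · obtain ⟨t, ht⟩ := hE
    simp only [ht, ← two_mul, pow_mul, hsq, one_pow, one_mul]
  · obtain ⟨t, ht⟩ := Nat.not_even_iff_odd.mp hE
    simp only [ht, pow_succ, pow_mul, hsq, one_pow, one_mul]

theorem neg_one_zpow_four_mul_add (i k : ℤ) : (-1 : ℝ) ^ (4 * i + k) = (-1 : ℝ) ^ k := by
  have h : Even (4 * i) := ⟨2 * i, by ring⟩
  rw [zpow_add₀ (by norm_num), h.neg_one_zpow, one_mul]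

theorem IsBinary.correlations_asymptotic (hw : IsBinary w) :
    IsAsymptoticSolution (d := d) atTop (fun N : ℕ => N / 4)
      (fun N m => etaAvg w m N) (fun N m => thetaAvg w m N) := by
  intro m
  have a0 := hw.avg_corr_four_mul_add m 0 (by norm_num)
  simp only [add_zero] at a0
  have a1 := hw.avg_corr_four_mul_add m 1 (by norm_num)
  have a2 := hw.avg_corr_four_mul_add m 2 (by norm_num)
  have a3 := hw.avg_corr_four_mul_add m 3 (by norm_num)
  constructor
  · refine (tendsto_avg_sub_avg_blocks fun i => (hw.abs_corr m i).le).congr fun N => ?_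
    simp only [avg_mul_left, avg_add, a0, a1, a2, a3]
    rfl
  · refine (tendsto_avg_sub_avg_blocks
      fun i => (hw.abs_neg_one_zpow_mul_corr m i).le).congr fun N => ?_
    have z0 : ∀ i : ℤ, (-1 : ℝ) ^ (4 * i) = 1 := fun i => by
      simpa using neg_one_zpow_four_mul_add i 0
    have z3 : (-1 : ℝ) ^ (3 : ℤ) = -1 := by norm_num
    have z2 : (-1 : ℝ) ^ (2 : ℤ) = 1 := by norm_num
    simp only [z0, neg_one_zpow_four_mul_add, z2, z3, zpow_one, avg_mul_left, avg_add,
      a0, a1, a2, a3, thetaAvg_eq]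
    ring

theorem IsBinary.abs_etaAvg_le (hw : IsBinary w) (m : Fin d → ℤ) (N : ℕ) :
    |etaAvg w m N| ≤ 1 :=
  abs_avg_le (fun i => (hw.abs_corr m i).le) N

theorem IsBinary.abs_thetaAvg_le (hw : IsBinary w) (m : Fin d → ℤ) (N : ℕ) :
    |thetaAvg w m N| ≤ 1 :=
  abs_avg_le (fun i => (hw.abs_neg_one_zpow_mul_corr m i).le) N

theorem tendsto_div_four : Tendsto (fun N : ℕ => N / 4) atTop atTop :=
  Nat.tendsto_div_const_atTop (by norm_num)

/-- For an even number `d + 1` of points, the summand at `m = 0` is `1`. For an odd number of points,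
the average is asymptotically half of its value at the preceding scale. -/
theorem IsBinary.exists_tendsto_etaAvg_zero (d : ℕ) :
    ∃ c : ℝ, ∀ w, IsBinary w →
      Tendsto (fun N => etaAvg w (fun _ : Fin d => 0) N) atTop (𝓝 c) := by
  rcases Nat.even_or_odd d with hd | hd
  · refine ⟨0, fun w hw => ?_⟩
    have h := (hw.correlations_asymptotic (d := d) fun _ => 0).1
    simp only [renormTerm_sum_zero_of_even hd] at h
    have h' := h.abs
    rw [abs_zero] at h'
    rw [tendsto_zero_iff_abs_tendsto_zero]
    refine tendsto_zero_of_le_half tendsto_div_four (fun N => abs_nonneg _)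
      (hw.abs_etaAvg_le _) h' fun N => ?_
    have := abs_add_le (1 / 2 * etaAvg w (fun _ : Fin d => 0) (N / 4))
      (etaAvg w (fun _ : Fin d => 0) N - 1 / 2 * etaAvg w (fun _ : Fin d => 0) (N / 4))
    rw [abs_mul, abs_of_pos (by norm_num : (0 : ℝ) < 1 / 2)] at this
    simpa using this
  · refine ⟨1, fun w hw => ?_⟩
    have h1 : corr w (fun _ : Fin d => 0) = fun _ => 1 := by
      funext i
      have : Even (d + 1) := hd.add_one
      rw [corr]
      simp only [add_zero, Finset.prod_const, Finset.card_univ, Fintype.card_fin, ← pow_succ']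
      rw [← this.pow_abs, hw.abs_eq_one, one_pow]
    simp only [etaAvg_eq, h1, avg_const]
    exact tendsto_const_nhds

/-- The averages for two sequences, up to two independent bounds, have asymptotically the same
values. -/
theorem IsBinary.tendsto_sub (hw : IsBinary w) {w' : ℤ → ℝ} (hw' : IsBinary w')
    (m : Fin d → ℤ) :
    Tendsto (fun p : ℕ × ℕ => etaAvg w m p.1 - etaAvg w' m p.2) (atTop ×ˢ atTop) (𝓝 0) ∧
    Tendsto (fun p : ℕ × ℕ => thetaAvg w m p.1 - thetaAvg w' m p.2) (atTop ×ˢ atTop) (𝓝 0) := by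
  have hs : Tendsto (fun p : ℕ × ℕ => (p.1 / 4, p.2 / 4)) (atTop ×ˢ atTop) (atTop ×ˢ atTop) :=
    tendsto_div_four.prodMap tendsto_div_four
  have h1 := (hw.correlations_asymptotic (d := d)).comp
    (s' := fun p : ℕ × ℕ => (p.1 / 4, p.2 / 4))
    (tendsto_fst (f := (atTop : Filter ℕ)) (g := (atTop : Filter ℕ))) fun _ => rfl
  have h2 := (hw'.correlations_asymptotic (d := d)).comp
    (s' := fun p : ℕ × ℕ => (p.1 / 4, p.2 / 4))
    (tendsto_snd (f := (atTop : Filter ℕ)) (g := (atTop : Filter ℕ))) fun _ => rfl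
  obtain ⟨c, hc⟩ := IsBinary.exists_tendsto_etaAvg_zero d
  refine (h1.sub h2).tendsto_zero hs (fun m => ⟨2, fun p => ?_⟩) (fun m => ⟨2, fun p => ?_⟩) ?_ m
  · exact (abs_sub _ _).trans (by
      linarith [hw.abs_etaAvg_le m p.1, hw'.abs_etaAvg_le m p.2])
  · exact (abs_sub _ _).trans (by
      linarith [hw.abs_thetaAvg_le m p.1, hw'.abs_thetaAvg_le m p.2])
  · simpa using ((hc w hw).comp tendsto_fst).sub ((hc w' hw').comp tendsto_snd)

theorem exists_tendsto_of_tendsto_sub {a : ℕ → ℝ}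
    (h : Tendsto (fun p : ℕ × ℕ => a p.1 - a p.2) (atTop ×ˢ atTop) (𝓝 0)) :
    ∃ c, Tendsto a atTop (𝓝 c) := by
  refine cauchySeq_tendsto_of_complete (cauchySeq_iff_tendsto_dist_atTop_0.mpr ?_)
  rw [← prod_atTop_atTop_eq]
  simpa [Real.dist_eq] using h.abs

theorem exists_isBinary : ∃ w, IsBinary w := by
  obtain ⟨v, hv, -⟩ := exists_isQuaternary 2 0 (by simp)
  exact ⟨_, v, hv, rfl⟩

theorem exists_correlations (d : ℕ) :
    ∃ η θ : (Fin d → ℤ) → ℝ,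
      (∀ w : ℤ → ℝ, IsBinary w → ∀ m : Fin d → ℤ,
        Tendsto (etaAvg w m) atTop (𝓝 (η m)) ∧ Tendsto (thetaAvg w m) atTop (𝓝 (θ m))) ∧
      IsRenormSolution η θ := by
  obtain ⟨w₀, hw₀⟩ := exists_isBinary
  choose η hη using fun m : Fin d → ℤ => exists_tendsto_of_tendsto_sub (hw₀.tendsto_sub hw₀ m).1
  choose θ hθ using fun m : Fin d → ℤ => exists_tendsto_of_tendsto_sub (hw₀.tendsto_sub hw₀ m).2
  have hdiag : Tendsto (fun N : ℕ => (N, N)) atTop (atTop ×ˢ atTop) :=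
    tendsto_id.prodMk tendsto_id
  refine ⟨η, θ, fun w hw m => ⟨?_, ?_⟩,
    hw₀.correlations_asymptotic.isRenormSolution tendsto_div_four hη hθ⟩
  · simpa [Function.comp_def] using ((hw.tendsto_sub hw₀ m).1.comp hdiag).add (hη m)
  · simpa [Function.comp_def] using ((hw.tendsto_sub hw₀ m).2.comp hdiag).add (hθ m)

end Correlation

end RudinShapiro

theorem mainTheorem1 (n : ℕ) (hn : 1 ≤ n) :
    ∃ η θ : (Fin (n - 1) → ℤ) → ℝ,
      -- all `n`-point correlations exist, with the same values for each Rudin--Shapiro sequence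
      (∀ w : ℤ → ℝ, RudinShapiro.IsBinary w → ∀ m : Fin (n - 1) → ℤ,
        Tendsto (RudinShapiro.etaAvg w m) atTop (𝓝 (η m)) ∧
        Tendsto (RudinShapiro.thetaAvg w m) atTop (𝓝 (θ m))) ∧
      -- they solve the renormalisation equations, whose solutions are determined by one value
      RudinShapiro.IsRenormSolution η θ ∧
      (∀ F G F' G' : (Fin (n - 1) → ℤ) → ℝ,
        RudinShapiro.IsRenormSolution F G → RudinShapiro.IsRenormSolution F' G' →
        F (fun _ => 0) = F' (fun _ => 0) → F = F' ∧ G = G') ∧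
      -- they vanish for odd `n`
      (Odd n → ∀ m : Fin (n - 1) → ℤ, η m = 0 ∧ θ m = 0) := by
  obtain ⟨d, rfl⟩ := Nat.exists_eq_add_of_le' hn
  obtain ⟨η, θ, h, hsol⟩ := RudinShapiro.exists_correlations d
  refine ⟨η, θ, h, hsol, fun F G F' G' h1 h2 h0 => h1.eq_of_eq_at_zero h2 h0, fun hodd m => ?_⟩
  have hd : Even d := by
    rcases Nat.even_or_odd d with he | ho
    · exact he
    · exact absurd ho.add_one (Nat.not_even_iff_odd.mpr hodd)
  obtain ⟨rfl, rfl⟩ := hsol.eq_zero_of_even hd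
  exact ⟨rfl, rfl⟩
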